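/- Let $(\overline M^{2n+1},\overline g)$ be a semi-Riemannian manifold with Levi-Civita connection $\overline\nabla$ and let $(\overline\phi,\xi,\eta,\overline g)$ be an indefinite almost contact metric structure on it: $\overline\phi$ is a $(1,1)$-tensor field, $\xi$ a vector field and $\eta$ a 1-form with $\overline\phi^2=-\mathbb I+\eta\otimes\xi$, $\eta(\xi)=1$, $\eta\circ\overline\phi=0$, $\overline\phi\xi=0$, $\overline g(\overline\phi\,\cdot,\overline\phi\,\cdot)=\overline g-\eta\otimes\eta$ and $\eta=\overline g(\xi,\cdot)$. Suppose that it is nearly $\mu$-Sasakian for some $\mu\in\mathbb R$, that is, $(\overline\nabla_X\overline\phi)Y+(\overline\nabla_Y\overline\phi)X=\mu\{2\overline g(X,Y)\xi-\eta(Y)X-\eta(X)Y\}$ for all vector fields $X,Y$ on $\overline M$. Let $M$ be an (immersed) $r$-lightlike submanifold of $\overline M$: $\mathrm{Rad}\,TM=TM\cap TM^\perp$ is a smooth distribution of constant rank $r>0$. Fix a screen distribution $S(TM)$ and a screen transversal bundle $S(TM^\perp)$, i.e. nondegenerate complements of $\mathrm{Rad}\,TM$ in $TM$ and in $TM^\perp$,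 and a lightlike transversal bundle $l\mathrm{tr}(TM)$, i.e. a bundle orthogonal to $S(TM)$ and $S(TM^\perp)$ that is locally spanned by fields $N_i$ with $\overline g(N_i,N_j)=0$ and $\overline g(E_i,N_j)=\delta_{ij}$ for a local frame $(E_i)$ of $\mathrm{Rad}\,TM$. Put $\mathrm{tr}(TM)=l\mathrm{tr}(TM)\perp S(TM^\perp)$; then $T\overline M|_M=TM\oplus\mathrm{tr}(TM)$. Suppose that $M$ is a QGCR-lightlike submanifold: there are smooth distributions $D_1,D_2,D_0,\overline D$ on $M$ and subbundles $\mathcal L\subset l\mathrm{tr}(TM)$, $\mathcal S\subset S(TM^\perp)$ such that $\mathrm{Rad}\,TM=D_1\oplus D_2$, $\overline\phi D_1=D_1$, $\overline\phi D_2\subset S(TM)$, $S(TM)=\{\overline\phi D_2\oplus\overline D\}\perp D_0$, $\overline\phi D_0\subseteq D_0$, $D_0$ is nondegenerate, and $\overline D=\overline\phi\mathcal S\oplus\overline\phi\mathcal L$. Suppose that $M$ is co-screen, i.e. $\xi\in\Gamma(S(TM^\perp))$, and put $D=\mathrm{Rad}\,TM\perp D_0\perp\overline\phi D_2$, so that $TM=D\oplus\overline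 D$. Suppose moreover that the transversal bundle decomposes as $\mathrm{tr}(TM)=\overline\phi\,\overline D\perp\mathcal G\perp\mathbb R\xi$ with a smooth subbundle $\mathcal G$ such that $\overline\phi\,\mathcal G=\mathcal G$. For $X,Y\in\Gamma(TM)$ and a section $V$ of $\mathrm{tr}(TM)$, let $\nabla_XY$ be the component in $TM$ of $\overline\nabla_XY$, let $A_VX$ be minus the component in $TM$ of $\overline\nabla_XV$, and let $\varphi_1X$ be the component in $\mathrm{tr}(TM)$ of $\overline\phi X$ (components with respect to $T\overline M|_M=TM\oplus\mathrm{tr}(TM)$). **Theorem.** If $\overline D$ is nearly auto-parallel, i.e. $\nabla_XY+\nabla_YX\in\Gamma(\overline D)$ for all $X,Y\in\Gamma(\overline D)$, then for all $X,Y\in\Gamma(\overline D)$ the vector field $A_{\varphi_1X}Y+A_{\overline\phi Y}X$ has no component in $D$ with respect to $TM=D\oplus\overline D$. -/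

import Mathlib

open scoped Manifold ContDiff
open Bundle

namespace LightlikeGeometry

/-! ### Semi-Riemannian manifolds and the Levi-Civita connection -/

section Ambient

variable {d : ℕ} {N : Type*} [TopologicalSpace N] [ChartedSpace (EuclideanSpace ℝ (Fin d)) N]
  [IsManifold (𝓡 d) ∞ N]

/-- A smooth vector field on `N` near the point `x` (smooth at `x`). -/
def SmoothFieldAt (X : ∀ x : N, TangentSpace (𝓡 d) x) (x : N) : Prop :=
  ContMDiffAt (𝓡 d) (𝓡 d).tangent ∞ (fun y => (⟨y, X y⟩ : TangentBundle (𝓡 d) N)) x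

variable (d N) in
/-- A semi-Riemannian metric: a smooth symmetric nondegenerate `(0,2)`-tensor field of
constant index. -/
structure SemiRiemannianMetric where
  /-- the bilinear form on each tangent space -/
  val : ∀ x : N, TangentSpace (𝓡 d) x →L[ℝ] TangentSpace (𝓡 d) x →L[ℝ] ℝ
  symm : ∀ x v w, val x v w = val x w v
  nondegenerate : ∀ x v, (∀ w, val x v w = 0) → v = 0
  contMDiff : ContMDiff (𝓡 d)
    ((𝓡 d).prod 𝓘(ℝ, EuclideanSpace ℝ (Fin d) →L[ℝ] EuclideanSpace ℝ (Fin d) →L[ℝ] ℝ)) ∞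
    (fun x => TotalSpace.mk' (EuclideanSpace ℝ (Fin d) →L[ℝ] EuclideanSpace ℝ (Fin d) →L[ℝ] ℝ)
      (E := fun x : N => TangentSpace (𝓡 d) x →L[ℝ] TangentSpace (𝓡 d) x →L[ℝ] ℝ) x (val x))
  /-- the index: the largest dimension of a negative definite subspace -/
  index : ℕ
  index_spec : ∀ x, IsGreatest {k : ℕ | ∃ W : Submodule ℝ (TangentSpace (𝓡 d) x),
    Module.finrank ℝ W = k ∧ ∀ w ∈ W, w ≠ 0 → val x w w < 0} index

/-- The Levi-Civita connection of `g`: the (unique) torsion-free connection on the tangent bundle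
that is compatible with `g`. As in Mathlib, `cov Y x (X x)` stands for `(∇_X Y)(x)`. -/
structure IsLeviCivita (g : SemiRiemannianMetric d N)
    (cov : CovariantDerivative (𝓡 d) (EuclideanSpace ℝ (Fin d))
      (TangentSpace (𝓡 d) : N → Type _)) : Prop where
  torsion_free : ∀ (X Y : ∀ x : N, TangentSpace (𝓡 d) x) (x : N),
    SmoothFieldAt X x → SmoothFieldAt Y x →
    cov Y x (X x) - cov X x (Y x) = VectorField.mlieBracket (𝓡 d) X Y x
  metric : ∀ (X Y : ∀ x : N, TangentSpace (𝓡 d) x) (x : N) (u : TangentSpace (𝓡 d) x),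
    SmoothFieldAt X x → SmoothFieldAt Y x →
    mfderiv (𝓡 d) 𝓘(ℝ, ℝ) (fun y => g.val y (X y) (Y y)) x u
      = g.val x (cov X x u) (Y x) + g.val x (X x) (cov Y x u)

/-- An indefinite almost contact metric structure `(φ, ξ, η)` on the semi-Riemannian manifold
`(N, g)`. -/
structure AlmostContactMetricStructure (g : SemiRiemannianMetric d N) where
  φ : ∀ x : N, TangentSpace (𝓡 d) x →L[ℝ] TangentSpace (𝓡 d) x
  ξ : ∀ x : N, TangentSpace (𝓡 d) x
  η : ∀ x : N, TangentSpace (𝓡 d) x →L[ℝ] ℝ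
  φ_smooth : ContMDiff (𝓡 d)
    ((𝓡 d).prod 𝓘(ℝ, EuclideanSpace ℝ (Fin d) →L[ℝ] EuclideanSpace ℝ (Fin d))) ∞
    (fun x => TotalSpace.mk' (EuclideanSpace ℝ (Fin d) →L[ℝ] EuclideanSpace ℝ (Fin d))
      (E := fun x : N => TangentSpace (𝓡 d) x →L[ℝ] TangentSpace (𝓡 d) x) x (φ x))
  ξ_smooth : ContMDiff (𝓡 d) (𝓡 d).tangent ∞ (fun x => (⟨x, ξ x⟩ : TangentBundle (𝓡 d) N))
  η_smooth : ContMDiff (𝓡 d) ((𝓡 d).prod 𝓘(ℝ, EuclideanSpace ℝ (Fin d) →L[ℝ] ℝ)) ∞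
    (fun x => TotalSpace.mk' (EuclideanSpace ℝ (Fin d) →L[ℝ] ℝ)
      (E := fun x : N => TangentSpace (𝓡 d) x →L[ℝ] ℝ) x (η x))
  φ_φ : ∀ x v, φ x (φ x v) = -v + η x v • ξ x
  η_ξ : ∀ x, η x (ξ x) = 1
  η_φ : ∀ x v, η x (φ x v) = 0
  φ_ξ : ∀ x, φ x (ξ x) = 0
  g_φ_φ : ∀ x v w, g.val x (φ x v) (φ x w) = g.val x v w - η x v * η x w
  η_eq : ∀ x v, η x v = g.val x (ξ x) v

/-- `(∇_X φ) Y` at `x`. -/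
noncomputable def covφ (cov : CovariantDerivative (𝓡 d) (EuclideanSpace ℝ (Fin d))
      (TangentSpace (𝓡 d) : N → Type _))
    (φ : ∀ x : N, TangentSpace (𝓡 d) x →L[ℝ] TangentSpace (𝓡 d) x)
    (X Y : ∀ x : N, TangentSpace (𝓡 d) x) (x : N) : TangentSpace (𝓡 d) x :=
  cov (fun y => φ y (Y y)) x (X x) - φ x (cov Y x (X x))

/-- The nearly `μ`-Sasakian condition. -/
def IsNearlySasakian (μ : ℝ) {g : SemiRiemannianMetric d N}
    (cov : CovariantDerivative (𝓡 d) (EuclideanSpace ℝ (Fin d))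
      (TangentSpace (𝓡 d) : N → Type _))
    (J : AlmostContactMetricStructure g) : Prop :=
  ∀ (X Y : ∀ x : N, TangentSpace (𝓡 d) x) (x : N), SmoothFieldAt X x → SmoothFieldAt Y x →
    covφ cov J.φ X Y x + covφ cov J.φ Y X x
      = μ • ((2 * g.val x (X x) (Y x)) • J.ξ x - J.η x (Y x) • X x - J.η x (X x) • Y x)

end Ambient

/-! ### Linear algebra in one tangent space -/

section Linear

/-- `C = A ⊕ B`, an internal direct sum of subspaces. -/
def IsDirectSum {V : Type*} [AddCommGroup V] [Module ℝ V] (A B C : Submodule ℝ V) : Prop :=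
  Disjoint A B ∧ A ⊔ B = C

end Linear

/-! ### Sections and distributions along a map -/

section Along

variable {m d : ℕ} {M N : Type*}
  [TopologicalSpace M] [ChartedSpace (EuclideanSpace ℝ (Fin m)) M] [IsManifold (𝓡 m) ∞ M]
  [TopologicalSpace N] [ChartedSpace (EuclideanSpace ℝ (Fin d)) N] [IsManifold (𝓡 d) ∞ N]

/-- Vector fields along `ι` (sections of the restriction of `TN` to `M`). -/
abbrev FieldAlong (d : ℕ) {M N : Type*} [TopologicalSpace N]
    [ChartedSpace (EuclideanSpace ℝ (Fin d)) N] (ι : M → N) : Type _ :=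
  ∀ p : M, TangentSpace (𝓡 d) (ι p)

/-- Families of subspaces of the restriction of `TN` to `M`. Subspaces of `T_p M` are regarded as
subspaces of `T_{ι p} N` through the differential of `ι`. -/
abbrev DistAlong (d : ℕ) {M N : Type*} [TopologicalSpace N]
    [ChartedSpace (EuclideanSpace ℝ (Fin d)) N] (ι : M → N) : Type _ :=
  ∀ p : M, Submodule ℝ (TangentSpace (𝓡 d) (ι p))

/-- A vector field along `ι` that is smooth on the set `U`. -/
def SmoothAlongOn (m : ℕ) {d : ℕ} {M N : Type*}
    [TopologicalSpace M] [ChartedSpace (EuclideanSpace ℝ (Fin m)) M]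
    [TopologicalSpace N] [ChartedSpace (EuclideanSpace ℝ (Fin d)) N] [IsManifold (𝓡 d) ∞ N]
    (ι : M → N) (V : FieldAlong d ι) (U : Set M) : Prop :=
  ContMDiffOn (𝓡 m) (𝓡 d).tangent ∞ (fun p => (⟨ι p, V p⟩ : TangentBundle (𝓡 d) N)) U

/-- `D` is a smooth vector subbundle of the restriction of `TN` to `M`: near each point it has a
smooth frame. -/
def IsSmoothDist (m : ℕ) {d : ℕ} {M N : Type*}
    [TopologicalSpace M] [ChartedSpace (EuclideanSpace ℝ (Fin m)) M]
    [TopologicalSpace N] [ChartedSpace (EuclideanSpace ℝ (Fin d)) N] [IsManifold (𝓡 d) ∞ N]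
    (ι : M → N) (D : DistAlong d ι) : Prop :=
  ∀ p : M, ∃ U : Set M, IsOpen U ∧ p ∈ U ∧ ∃ (k : ℕ) (V : Fin k → FieldAlong d ι),
    (∀ i, SmoothAlongOn m ι (V i) U) ∧
    ∀ q ∈ U, LinearIndependent ℝ (fun i => V i q) ∧
      Submodule.span ℝ (Set.range fun i => V i q) = D q

/-- The covariant derivative of a vector field `V` along `ι` in the direction `u ∈ T_p M`, for the
connection `cov` on `N`. In the frame `e_i` of `TN` given by the chart at `ι p`, if
`V = ∑ v^i (e_i ∘ ι)` then this is `∑ dv^i(u) e_i + ∑ v^i(p) ∇_{dι u} e_i`. -/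
noncomputable def covAlong (cov : CovariantDerivative (𝓡 d) (EuclideanSpace ℝ (Fin d))
      (TangentSpace (𝓡 d) : N → Type _))
    (ι : M → N) (V : FieldAlong d ι) (p : M) (u : TangentSpace (𝓡 m) p) :
    TangentSpace (𝓡 d) (ι p) :=
  (trivializationAt (EuclideanSpace ℝ (Fin d)) (TangentSpace (𝓡 d) : N → Type _) (ι p)).symm (ι p)
    (mfderiv (𝓡 m) 𝓘(ℝ, EuclideanSpace ℝ (Fin d))
      (fun q => (trivializationAt (EuclideanSpace ℝ (Fin d))
        (TangentSpace (𝓡 d) : N → Type _) (ι p) ⟨ι q, V q⟩).2) p u)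
  + cov (FiberBundle.extend (EuclideanSpace ℝ (Fin d)) (V p)) (ι p) (mfderiv (𝓡 m) (𝓡 d) ι p u)

/-- The tangent bundle of `M`, as a family of subspaces along `ι`. -/
noncomputable def tangentDist (m : ℕ) {d : ℕ} {M N : Type*}
    [TopologicalSpace M] [ChartedSpace (EuclideanSpace ℝ (Fin m)) M]
    [TopologicalSpace N] [ChartedSpace (EuclideanSpace ℝ (Fin d)) N]
    (ι : M → N) : DistAlong d ι :=
  fun p => LinearMap.range (mfderiv (𝓡 m) (𝓡 d) ι p).toLinearMap

/-- `dι X`, the vector field `X` on `M` regarded as a vector field along `ι`. -/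
noncomputable def push (ι : M → N) (X : ∀ p : M, TangentSpace (𝓡 m) p) : FieldAlong d ι :=
  fun p => mfderiv (𝓡 m) (𝓡 d) ι p (X p)

variable (g : SemiRiemannianMetric d N)

/-- The bilinear form of `g` at `x`. -/
noncomputable def SemiRiemannianMetric.form (x : N) :
    LinearMap.BilinForm ℝ (TangentSpace (𝓡 d) x) :=
  LinearMap.mk₂ ℝ (fun v w => g.val x v w) (by simp) (by simp) (by simp) (by simp)

/-- Orthogonality of two subspaces of a tangent space. -/
def SemiRiemannianMetric.Orth {x : N} (A B : Submodule ℝ (TangentSpace (𝓡 d) x)) : Prop :=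
  ∀ v ∈ A, ∀ w ∈ B, g.val x v w = 0

/-- The metric is nondegenerate on the subspace `A`. -/
def SemiRiemannianMetric.NondegOn {x : N} (A : Submodule ℝ (TangentSpace (𝓡 d) x)) : Prop :=
  ∀ v ∈ A, (∀ w ∈ A, g.val x v w = 0) → v = 0

/-- The normal bundle `TM^⊥`. -/
noncomputable def normalDist (m : ℕ) {M : Type*}
    [TopologicalSpace M] [ChartedSpace (EuclideanSpace ℝ (Fin m)) M] (ι : M → N) :
    DistAlong d ι :=
  fun p => (g.form (ι p)).orthogonal (tangentDist m ι p)

/-- The radical distribution `Rad TM = TM ∩ TM^⊥`. -/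
noncomputable def radDist (m : ℕ) {M : Type*}
    [TopologicalSpace M] [ChartedSpace (EuclideanSpace ℝ (Fin m)) M] (ι : M → N) :
    DistAlong d ι :=
  fun p => tangentDist m ι p ⊓ normalDist g m ι p

/-- `(M, g, S(TM), S(TM^⊥))` is an `r`-lightlike submanifold of `(N, g)`, immersed by `ι`, with a
chosen lightlike transversal bundle `ltr(TM)`. -/
structure LightlikeSubmanifold (m : ℕ) {M : Type*} [TopologicalSpace M]
    [ChartedSpace (EuclideanSpace ℝ (Fin m)) M] [IsManifold (𝓡 m) ∞ M] (ι : M → N) where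
  smooth : ContMDiff (𝓡 m) (𝓡 d) ∞ ι
  immersion : ∀ p, Function.Injective (mfderiv (𝓡 m) (𝓡 d) ι p)
  /-- the rank of the radical distribution -/
  r : ℕ
  r_pos : 0 < r
  rad_smooth : IsSmoothDist m ι (radDist g m ι)
  rad_rank : ∀ p, Module.finrank ℝ (radDist g m ι p) = r
  /-- the screen distribution `S(TM)` -/
  screen : DistAlong d ι
  screen_smooth : IsSmoothDist m ι screen
  screen_nondeg : ∀ p, g.NondegOn (screen p)
  tangent_eq : ∀ p, IsDirectSum (radDist g m ι p) (screen p) (tangentDist m ι p)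
  /-- the screen transversal bundle `S(TM^⊥)` -/
  screenTr : DistAlong d ι
  screenTr_smooth : IsSmoothDist m ι screenTr
  screenTr_nondeg : ∀ p, g.NondegOn (screenTr p)
  normal_eq : ∀ p, IsDirectSum (radDist g m ι p) (screenTr p) (normalDist g m ι p)
  /-- the lightlike transversal bundle `ltr(TM)` -/
  ltr : DistAlong d ι
  ltr_orth_screen : ∀ p, g.Orth (ltr p) (screen p)
  ltr_orth_screenTr : ∀ p, g.Orth (ltr p) (screenTr p)
  ltr_frame : ∀ p : M, ∃ U : Set M, IsOpen U ∧ p ∈ U ∧ ∃ E F : Fin r → FieldAlong d ι,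
    (∀ i, SmoothAlongOn m ι (E i) U) ∧ (∀ i, SmoothAlongOn m ι (F i) U) ∧
    ∀ q ∈ U, Submodule.span ℝ (Set.range fun i => E i q) = radDist g m ι q ∧
      Submodule.span ℝ (Set.range fun i => F i q) = ltr q ∧
      (∀ i j, g.val (ι q) (E i q) (F j q) = if i = j then 1 else 0) ∧
      ∀ i j, g.val (ι q) (F i q) (F j q) = 0

end Along

section Submanifold

variable {m d : ℕ} {M N : Type*}
  [TopologicalSpace M] [ChartedSpace (EuclideanSpace ℝ (Fin m)) M] [IsManifold (𝓡 m) ∞ M]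
  [TopologicalSpace N] [ChartedSpace (EuclideanSpace ℝ (Fin d)) N] [IsManifold (𝓡 d) ∞ N]
  {g : SemiRiemannianMetric d N} {ι : M → N}

namespace LightlikeSubmanifold

variable (L : LightlikeSubmanifold g m ι)

/-- The transversal bundle `tr(TM) = ltr(TM) ⊥ S(TM^⊥)`. -/
noncomputable def tr : DistAlong d ι := fun p => L.ltr p ⊔ L.screenTr p

lemma isCompl_tangent_tr (p : M) : IsCompl (tangentDist m ι p) (L.tr p) := by
  classical
  obtain ⟨U, -, hpU, E, F, -, -, hq⟩ := L.ltr_frame p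
  obtain ⟨hE, hF, hEF, -⟩ := hq p hpU
  have hEmem : ∀ i, E i p ∈ radDist g m ι p := fun i => by
    rw [← hE]; exact Submodule.subset_span ⟨i, rfl⟩
  have hsymm := g.symm (ι p)
  have hnd : (g.form (ι p)).Nondegenerate := by
    refine ⟨fun v hv => g.nondegenerate _ v hv, fun v hv => g.nondegenerate _ v fun w => ?_⟩
    rw [hsymm]; exact hv w
  have hnormal : ∀ v ∈ normalDist g m ι p, ∀ w ∈ tangentDist m ι p, g.val (ι p) v w = 0 := by
    intro v hv w hw
    rw [hsymm]; exact hv w hw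
  have hSN : ∀ w ∈ L.screenTr p, w ∈ normalDist g m ι p := fun w hw => by
    rw [← (L.normal_eq p).2]; exact Submodule.mem_sup_right hw
  -- a vector of `ltr` that is orthogonal to the radical vanishes
  have hltr : ∀ v ∈ L.ltr p, (∀ i, g.val (ι p) (E i p) v = 0) → v = 0 := by
    intro v hv h0
    rw [← hF, Submodule.mem_span_range_iff_exists_fun] at hv
    obtain ⟨c, rfl⟩ := hv
    have hc : ∀ i, c i = 0 := fun i => by
      have := h0 i
      simpa [map_sum, hEF] using this
    simp [hc]
  have hltrS : Disjoint (L.ltr p) (L.screenTr p) := by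
    rw [Submodule.disjoint_def]
    intro v hv hw
    exact hltr v hv fun i => by
      rw [hsymm]; exact hnormal v (hSN v hw) _ (hEmem i).1
  have hdisj : Disjoint (tangentDist m ι p) (L.tr p) := by
    rw [Submodule.disjoint_def]
    intro v hv hw
    obtain ⟨a, ha, b, hb, rfl⟩ := Submodule.mem_sup.1 hw
    have ha0 : a = 0 := hltr a ha fun i => by
      have h1 := hnormal _ (hEmem i).2 _ hv
      have h2 : g.val (ι p) (E i p) b = 0 := by
        rw [hsymm]; exact hnormal b (hSN b hb) _ (hEmem i).1
      simpa [h2] using h1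
    subst ha0
    rw [zero_add] at hv ⊢
    exact (Submodule.disjoint_def.1 (L.normal_eq p).1) b ⟨hv, hSN b hb⟩ hb
  have : FiniteDimensional ℝ (TangentSpace (𝓡 d) (ι p)) :=
    inferInstanceAs (FiniteDimensional ℝ (EuclideanSpace ℝ (Fin d)))
  have hli : LinearIndependent ℝ (fun i => F i p) := by
    rw [Fintype.linearIndependent_iff]
    intro c hc i
    have := congrArg (g.val (ι p) (E i p)) hc
    simpa [map_sum, hEF] using this
  have hrk : Module.finrank ℝ (L.ltr p) = L.r := by
    rw [← hF, finrank_span_eq_card hli, Fintype.card_fin]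
  have e1 := Submodule.finrank_sup_add_finrank_inf_eq (L.ltr p) (L.screenTr p)
  rw [hltrS.eq_bot, finrank_bot, hrk] at e1
  have e2 := Submodule.finrank_sup_add_finrank_inf_eq (radDist g m ι p) (L.screenTr p)
  rw [(L.normal_eq p).1.eq_bot, finrank_bot, (L.normal_eq p).2, L.rad_rank p] at e2
  have e3 := LinearMap.BilinForm.finrank_orthogonal hnd (tangentDist m ι p)
  have e4 := Submodule.finrank_le (tangentDist (d := d) m ι p)
  have e5 := Submodule.finrank_sup_add_finrank_inf_eq (tangentDist (d := d) m ι p) (L.tr p)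
  rw [hdisj.eq_bot, finrank_bot] at e5
  refine ⟨hdisj, codisjoint_iff.2 (Submodule.eq_top_of_finrank_eq ?_)⟩
  change Module.finrank ℝ (normalDist g m ι p) = _ at e3
  change Module.finrank ℝ (L.tr p) + 0 = _ at e1
  omega

/-- The projection of `TN` restricted to `M` onto `TM` along `tr(TM)`. -/
noncomputable def tanProj (p : M) : TangentSpace (𝓡 d) (ι p) →ₗ[ℝ] TangentSpace (𝓡 d) (ι p) :=
  (tangentDist m ι p).projection (L.tr p) (L.isCompl_tangent_tr p)

/-- The projection of `TN` restricted to `M` onto `tr(TM)` along `TM`. -/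
noncomputable def trProj (p : M) : TangentSpace (𝓡 d) (ι p) →ₗ[ℝ] TangentSpace (𝓡 d) (ι p) :=
  (L.tr p).projection (tangentDist m ι p) (L.isCompl_tangent_tr p).symm

variable (cov : CovariantDerivative (𝓡 d) (EuclideanSpace ℝ (Fin d))
  (TangentSpace (𝓡 d) : N → Type _))

/-- The induced connection `∇_X Y` on `TM` (Gauss formula: the tangential part of the ambient
covariant derivative). -/
noncomputable def inducedConn (X Y : ∀ p : M, TangentSpace (𝓡 m) p) : FieldAlong d ι :=
  fun p => L.tanProj p (covAlong cov ι (push ι Y) p (X p))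

/-- The shape operator `A_V X` of a transversal field `V` (Weingarten formula: minus the
tangential part of the ambient covariant derivative of `V` in the direction `X`). -/
noncomputable def shape (V : FieldAlong d ι) (X : ∀ p : M, TangentSpace (𝓡 m) p) :
    FieldAlong d ι :=
  fun p => -L.tanProj p (covAlong cov ι V p (X p))

/-- Smooth sections on `M` of a distribution `D` contained in `TM`. -/
def IsSection (_L : LightlikeSubmanifold g m ι) (D : DistAlong d ι)
    (X : ∀ p : M, TangentSpace (𝓡 m) p) : Prop :=
  ContMDiff (𝓡 m) (𝓡 m).tangent ∞ (fun p => (⟨p, X p⟩ : TangentBundle (𝓡 m) M)) ∧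
    ∀ p, push ι X p ∈ D p

/-- `D` is nearly auto-parallel. -/
def NearlyAutoParallel (D : DistAlong d ι) : Prop :=
  ∀ X Y : ∀ p : M, TangentSpace (𝓡 m) p, L.IsSection D X → L.IsSection D Y →
    ∀ p, L.inducedConn cov X Y p + L.inducedConn cov Y X p ∈ D p

end LightlikeSubmanifold

/-- The image under `φ` of a family of subspaces. -/
noncomputable def AlmostContactMetricStructure.image (J : AlmostContactMetricStructure g) (D : DistAlong d ι) :
    DistAlong d ι :=
  fun p => (D p).map (J.φ (ι p)).toLinearMap

/-- A quasi generalized CR (QGCR) structure on a lightlike submanifold of an almost contact metric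
manifold. -/
structure QGCR (J : AlmostContactMetricStructure g) (L : LightlikeSubmanifold g m ι) where
  D₁ : DistAlong d ι
  D₂ : DistAlong d ι
  D₀ : DistAlong d ι
  /-- the distribution `D̄` -/
  Dbar : DistAlong d ι
  /-- the subbundle `𝓛` of `ltr(TM)` -/
  Lsub : DistAlong d ι
  /-- the subbundle `𝓢` of `S(TM^⊥)` -/
  Ssub : DistAlong d ι
  D₁_smooth : IsSmoothDist m ι D₁
  D₂_smooth : IsSmoothDist m ι D₂
  D₀_smooth : IsSmoothDist m ι D₀
  Dbar_smooth : IsSmoothDist m ι Dbar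
  Lsub_smooth : IsSmoothDist m ι Lsub
  Ssub_smooth : IsSmoothDist m ι Ssub
  Lsub_le : ∀ p, Lsub p ≤ L.ltr p
  Ssub_le : ∀ p, Ssub p ≤ L.screenTr p
  rad_eq : ∀ p, IsDirectSum (D₁ p) (D₂ p) (radDist g m ι p)
  φ_D₁ : ∀ p, J.image D₁ p = D₁ p
  φ_D₂ : ∀ p, J.image D₂ p ≤ L.screen p
  φD₂_Dbar : ∀ p, Disjoint (J.image D₂ p) (Dbar p)
  screen_eq : ∀ p, IsDirectSum (J.image D₂ p ⊔ Dbar p) (D₀ p) (L.screen p)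
  screen_orth : ∀ p, g.Orth (J.image D₂ p ⊔ Dbar p) (D₀ p)
  φ_D₀ : ∀ p, J.image D₀ p ≤ D₀ p
  D₀_nondeg : ∀ p, g.NondegOn (D₀ p)
  Dbar_eq : ∀ p, IsDirectSum (J.image Ssub p) (J.image Lsub p) (Dbar p)

namespace QGCR

variable {J : AlmostContactMetricStructure g} {L : LightlikeSubmanifold g m ι} (Q : QGCR J L)

/-- `M` is co-screen: `ξ` is a section of `S(TM^⊥)`. -/
def IsCoScreen (_Q : QGCR J L) : Prop := ∀ p, J.ξ (ι p) ∈ L.screenTr p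

/-- The decomposition `tr(TM) = φ D̄ ⊥ 𝓖 ⊥ ℝξ` with a `φ`-invariant subbundle `𝓖`. -/
structure IsTransversalSplitting (G : DistAlong d ι) : Prop where
  smooth : IsSmoothDist m ι G
  invariant : ∀ p, J.image G p = G p
  orth : ∀ p, g.Orth (J.image Q.Dbar p) (G p)
  orth_ξ : ∀ p, g.Orth (J.image Q.Dbar p ⊔ G p) (Submodule.span ℝ {J.ξ (ι p)})
  disjoint : ∀ p, Disjoint (J.image Q.Dbar p) (G p)
  tr_eq : ∀ p, IsDirectSum (J.image Q.Dbar p ⊔ G p) (Submodule.span ℝ {J.ξ (ι p)}) (L.tr p)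

/-- The distribution `D = Rad TM ⊥ D₀ ⊥ φ D₂` of a co-screen submanifold, for which
`TM = D ⊕ D̄`. -/
noncomputable def D : DistAlong d ι := fun p => radDist g m ι p ⊔ Q.D₀ p ⊔ J.image Q.D₂ p

lemma tangent_eq_D (p : M) : IsDirectSum (Q.D p) (Q.Dbar p) (tangentDist m ι p) := by
  have hs := (Q.screen_eq p).2
  have ht := (L.tangent_eq p).2
  constructor
  · have h1 : Disjoint (radDist g m ι p) ((J.image Q.D₂ p ⊔ Q.D₀ p) ⊔ Q.Dbar p) := by
      rw [sup_right_comm, hs]; exact (L.tangent_eq p).1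
    have h2 : Disjoint (J.image Q.D₂ p ⊔ Q.D₀ p) (Q.Dbar p) := by
      rw [sup_comm]
      refine Disjoint.disjoint_sup_left_of_disjoint_sup_right (Q.φD₂_Dbar p) ?_
      exact (Q.screen_eq p).1.symm
    have h3 := h2.symm.disjoint_sup_right_of_disjoint_sup_left (c := radDist g m ι p) (by
      rw [sup_comm]; exact h1.symm)
    have h4 : Q.D p = (J.image Q.D₂ p ⊔ Q.D₀ p) ⊔ radDist g m ι p := by
      simp only [D, sup_comm, sup_left_comm]
    rw [h4]; exact h3.symm
  · rw [← ht, ← hs]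
    simp only [D, sup_comm, sup_left_comm]

lemma isCompl_D (p : M) : IsCompl (Q.D p) (Q.Dbar p ⊔ L.tr p) := by
  have h := Q.tangent_eq_D p
  have h2 := L.isCompl_tangent_tr p
  rw [← h.2] at h2
  exact ⟨h.1.disjoint_sup_right_of_disjoint_sup_left h2.disjoint, by
    rw [codisjoint_iff, ← sup_assoc]; exact h2.sup_eq_top⟩

/-- The component in `D` of a vector, for the decomposition `TM ⊕ tr(TM) = D ⊕ D̄ ⊕ tr(TM)`; on
`TM` this is the projection onto `D` of `TM = D ⊕ D̄`. -/
noncomputable def projD (p : M) : TangentSpace (𝓡 d) (ι p) →ₗ[ℝ] TangentSpace (𝓡 d) (ι p) :=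
  (Q.D p).projection (Q.Dbar p ⊔ L.tr p) (Q.isCompl_D p)

/-- `φ X` for a vector field `X` on `M`, as a vector field along `ι`. -/
noncomputable def φTan (_Q : QGCR J L) (X : ∀ p : M, TangentSpace (𝓡 m) p) : FieldAlong d ι :=
  fun p => J.φ (ι p) (push ι X p)

/-- The transversal part of `φ X` for a vector field `X` on `M`. -/
noncomputable def φTr (_Q : QGCR J L) (X : ∀ p : M, TangentSpace (𝓡 m) p) : FieldAlong d ι :=
  fun p => L.trProj p (J.φ (ι p) (push ι X p))

end QGCR

end Submanifold

end LightlikeGeometry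

open LightlikeGeometry

/-! For `X`, `Y` in `D̄` the fields `φX`, `φY` are transversal, so `A_{φX}Y + A_{φY}X` is minus the
tangential part of `∇̄_Y φX + ∇̄_X φY`. Since `ξ` is normal, `η` vanishes on `TM`, and the nearly
`μ`-Sasakian identity turns this sum into `φ c + 2μ g(X,Y) ξ` with `c = ∇̄_X Y + ∇̄_Y X`. The
tangential part of `c` lies in `D̄` by near auto-parallelism, so `φ` sends it into `tr(TM)`; its
transversal part is sent into `D̄ ⊕ tr(TM)` (`φ_mem_of_mem_tr`). As `ξ` is transversal too, the
whole sum lies in `D̄ ⊕ tr(TM)`, and its tangential part has no `D`-component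
(`projD_tanProj_eq_zero`).

The analytic work is to use the nearly Sasakian identity, which concerns fields on the ambient
manifold, for fields along an immersion. It transfers because `∇φ` is tensorial
(`covAlong_endomorphism_sub`), so the values at one point suffice. -/

namespace LightlikeGeometry

/-! ### Manifold derivatives: the product rule for operator-valued functions. -/

section Calculus

variable {E H M F F' : Type*} [NormedAddCommGroup E] [NormedSpace ℝ E] [TopologicalSpace H]
  {I : ModelWithCorners ℝ E H} [TopologicalSpace M] [ChartedSpace H M]
  [NormedAddCommGroup F] [NormedSpace ℝ F] [NormedAddCommGroup F'] [NormedSpace ℝ F']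

lemma mvfderiv_congr {f f' : M → F} {x : M} (h : f =ᶠ[nhds x] f') :
    mvfderiv I f x = mvfderiv I f' x :=
  h.mfderiv_eq

lemma mvfderiv_clm_apply {A : M → F →L[ℝ] F'} {v : M → F} {x : M}
    (hA : MDifferentiableAt I 𝓘(ℝ, F →L[ℝ] F') A x) (hv : MDifferentiableAt I 𝓘(ℝ, F) v x)
    (u : TangentSpace I x) :
    mvfderiv I (fun y => A y (v y)) x u
      = mvfderiv I A x u (v x) + A x (mvfderiv I v x u) := by
  have h : HasMFDerivAt I 𝓘(ℝ, F') (fun y => A y (v y)) x _ :=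
    ⟨hA.continuousAt.clm_apply hv.continuousAt,
      hA.hasMFDerivAt.2.clm_apply hv.hasMFDerivAt.2⟩
  have h' := congrArg (fun L : E →L[ℝ] F' => L u) h.mfderiv
  simp only [writtenInExtChartAt, extChartAt_to_inv, Function.comp_apply] at h'
  exact h'.trans (add_comm _ _)

end Calculus

/-! ### Connections in a trivialization, and the Leibniz rule for `φ` along a map. -/

section Connection

variable {d : ℕ} {N : Type*} [TopologicalSpace N] [ChartedSpace (EuclideanSpace ℝ (Fin d)) N]
  [IsManifold (𝓡 d) ∞ N]

lemma smoothFieldAt_extend {x : N} (v : TangentSpace (𝓡 d) x) :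
    SmoothFieldAt (FiberBundle.extend (EuclideanSpace ℝ (Fin d)) v) x :=
  FiberBundle.contMDiffAt_extend ..

/-- A connection is the derivative in the trivialization at `x` plus a zeroth order term. -/
lemma cov_eq_symmL_mvfderiv_add (cov : CovariantDerivative (𝓡 d) (EuclideanSpace ℝ (Fin d))
      (TangentSpace (𝓡 d) : N → Type _)) {σ : ∀ y : N, TangentSpace (𝓡 d) y} {x : N}
    (hσ : MDifferentiableAt (𝓡 d) (𝓡 d).tangent
      (fun y => (⟨y, σ y⟩ : TangentBundle (𝓡 d) N)) x) (w : TangentSpace (𝓡 d) x) :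
    cov σ x w = (trivializationAt (EuclideanSpace ℝ (Fin d))
        (TangentSpace (𝓡 d) : N → Type _) x).symmL ℝ x
      (mvfderiv (𝓡 d) (fun y => (trivializationAt (EuclideanSpace ℝ (Fin d))
          (TangentSpace (𝓡 d) : N → Type _) x ⟨y, σ y⟩).2) x w)
      + cov (FiberBundle.extend (EuclideanSpace ℝ (Fin d)) (σ x)) x w := by
  set F := EuclideanSpace ℝ (Fin d)
  set e := trivializationAt F (TangentSpace (𝓡 d) : N → Type _) x with he
  have hx : x ∈ e.baseSet := FiberBundle.mem_baseSet_trivializationAt' x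
  have hdiff : ∀ {τ : ∀ y : N, TangentSpace (𝓡 d) y},
      MDifferentiableAt (𝓡 d) (𝓡 d).tangent (fun y => (⟨y, τ y⟩ : TangentBundle (𝓡 d) N)) x →
      MDifferentiableAt (𝓡 d) 𝓘(ℝ, F) (fun y => (e ⟨y, τ y⟩).2) x :=
    fun h => (mdifferentiableAt_section _ _).1 h
  have hnear : ∀ᶠ y in nhds x, y ∈ e.baseSet := e.open_baseSet.mem_nhds hx
  let Φ : (∀ y : N, TangentSpace (𝓡 d) y) → TangentSpace (𝓡 d) x := fun τ =>
    cov τ x w - e.symmL ℝ x (mvfderiv (𝓡 d) (fun y => (e ⟨y, τ y⟩).2) x w)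
  have hΦ : TensorialAt (𝓡 d) F Φ x := by
    constructor
    · intro f τ hf hτ
      have h : (fun y => (e ⟨y, (f • τ) y⟩).2) =ᶠ[nhds x] f • fun y => (e ⟨y, τ y⟩).2 := by
        filter_upwards [hnear] with y hy
        simp only [Pi.smul_apply', ← e.continuousLinearMapAt_apply_of_mem (R := ℝ) hy, map_smul]
      -- Makes the two `df(w) τ(x)` terms agree, so that they cancel in `Φ (f • τ)`.
      have h3 : e.symmL ℝ x ((e ⟨x, τ x⟩).2) = τ x := by
        rw [e.symmL_apply hx, e.symm_apply_apply_mk hx]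
      simp only [Φ]
      rw [cov.isCovariantDerivativeOnUniv.leibniz hτ hf, mvfderiv_congr h,
        mvfderiv_smul hf (hdiff hτ)]
      simp only [add_apply, smul_apply,
        ContinuousLinearMap.smulRight_apply, map_add, map_smul, h3]
      module
    · intro τ τ' hτ hτ'
      have h : (fun y => (e ⟨y, (τ + τ') y⟩).2) =ᶠ[nhds x]
          (fun y => (e ⟨y, τ y⟩).2) + fun y => (e ⟨y, τ' y⟩).2 := by
        filter_upwards [hnear] with y hy
        simp only [Pi.add_apply, ← e.continuousLinearMapAt_apply_of_mem (R := ℝ) hy, map_add]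
      simp only [Φ]
      rw [cov.isCovariantDerivativeOnUniv.add hτ hτ', mvfderiv_congr h,
        mvfderiv_add (hdiff hτ) (hdiff hτ')]
      simp only [add_apply, map_add]
      module
  have hext := hΦ.pointwise hσ (FiberBundle.mdifferentiableAt_extend (I := 𝓡 d) F (σ x))
    (by simp)
  -- `FiberBundle.extend` is constant in the trivialization near `x`, so only its connection term
  -- survives.
  have h0 : mvfderiv (𝓡 d) (fun y => (e ⟨y, FiberBundle.extend F (σ x) y⟩).2) x = 0 := by
    have h : (fun y => (e ⟨y, FiberBundle.extend F (σ x) y⟩).2) =ᶠ[nhds x]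
        fun _ => (e ⟨x, σ x⟩).2 := by
      filter_upwards [hnear] with y hy
      simp only [FiberBundle.extend]
      rw [e.apply_mk_symm hy]
    rw [mvfderiv_congr h, mvfderiv_const]
  simp only [Φ, h0, zero_apply, map_zero, sub_zero] at hext
  rwa [sub_eq_iff_eq_add'] at hext

/-- The coordinate expression of `φ v` in the trivialization at `x`. -/
lemma trivializationAt_apply_eq_inCoordinates {x y : N}
    (hy : y ∈ (trivializationAt (EuclideanSpace ℝ (Fin d))
      (TangentSpace (𝓡 d) : N → Type _) x).baseSet)
    (φ : TangentSpace (𝓡 d) y →L[ℝ] TangentSpace (𝓡 d) y) (v : TangentSpace (𝓡 d) y) :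
    (trivializationAt (EuclideanSpace ℝ (Fin d)) (TangentSpace (𝓡 d) : N → Type _) x
        ⟨y, φ v⟩).2
      = ContinuousLinearMap.inCoordinates (EuclideanSpace ℝ (Fin d)) (TangentSpace (𝓡 d))
          (EuclideanSpace ℝ (Fin d)) (TangentSpace (𝓡 d)) x y x y φ
        (trivializationAt (EuclideanSpace ℝ (Fin d)) (TangentSpace (𝓡 d) : N → Type _) x
          ⟨y, v⟩).2 := by
  rw [ContinuousLinearMap.inCoordinates, ContinuousLinearMap.comp_apply,
    ContinuousLinearMap.comp_apply, Trivialization.symmL_apply _ hy,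
    Trivialization.symm_apply_apply_mk _ hy,
    Trivialization.continuousLinearMapAt_apply_of_mem (R := ℝ) (hb := hy)]

variable {m : ℕ} {M : Type*} [TopologicalSpace M] [ChartedSpace (EuclideanSpace ℝ (Fin m)) M]

lemma covAlong_eq_symmL (cov : CovariantDerivative (𝓡 d) (EuclideanSpace ℝ (Fin d))
      (TangentSpace (𝓡 d) : N → Type _)) (ι : M → N) (V : FieldAlong d ι) (p : M)
    (u : TangentSpace (𝓡 m) p) :
    covAlong cov ι V p u = (trivializationAt (EuclideanSpace ℝ (Fin d))
        (TangentSpace (𝓡 d) : N → Type _) (ι p)).symmL ℝ (ι p)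
      (mvfderiv (𝓡 m) (fun q => (trivializationAt (EuclideanSpace ℝ (Fin d))
          (TangentSpace (𝓡 d) : N → Type _) (ι p) ⟨ι q, V q⟩).2) p u)
      + cov (FiberBundle.extend (EuclideanSpace ℝ (Fin d)) (V p)) (ι p)
        (mfderiv (𝓡 m) (𝓡 d) ι p u) := by
  rw [Trivialization.symmL_apply _ (FiberBundle.mem_baseSet_trivializationAt' (ι p))]
  rfl

/-- The Leibniz rule for `φ V` along a map: `∇_u (φ V) - φ (∇_u V)` depends only on `u` and the
value of `V`. -/
lemma covAlong_endomorphism_sub (cov : CovariantDerivative (𝓡 d) (EuclideanSpace ℝ (Fin d))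
      (TangentSpace (𝓡 d) : N → Type _)) (ι : M → N)
    (φ : ∀ x : N, TangentSpace (𝓡 d) x →L[ℝ] TangentSpace (𝓡 d) x)
    (V : FieldAlong d ι) (p : M) (u : TangentSpace (𝓡 m) p)
    (hφ : MDifferentiableAt (𝓡 d)
      ((𝓡 d).prod 𝓘(ℝ, EuclideanSpace ℝ (Fin d) →L[ℝ] EuclideanSpace ℝ (Fin d)))
      (fun x => TotalSpace.mk' (EuclideanSpace ℝ (Fin d) →L[ℝ] EuclideanSpace ℝ (Fin d))
        (E := fun x : N => TangentSpace (𝓡 d) x →L[ℝ] TangentSpace (𝓡 d) x) x (φ x)) (ι p))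
    (hι : MDifferentiableAt (𝓡 m) (𝓡 d) ι p)
    (hV : MDifferentiableAt (𝓡 m) (𝓡 d).tangent
      (fun q => (⟨ι q, V q⟩ : TangentBundle (𝓡 d) N)) p) :
    covAlong cov ι (fun q => φ (ι q) (V q)) p u - φ (ι p) (covAlong cov ι V p u)
      = cov (fun y => φ y (FiberBundle.extend (EuclideanSpace ℝ (Fin d)) (V p) y)) (ι p)
          (mfderiv (𝓡 m) (𝓡 d) ι p u)
        - φ (ι p) (cov (FiberBundle.extend (EuclideanSpace ℝ (Fin d)) (V p)) (ι p)
          (mfderiv (𝓡 m) (𝓡 d) ι p u)) := by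
  set F := EuclideanSpace ℝ (Fin d)
  set e := trivializationAt F (TangentSpace (𝓡 d) : N → Type _) (ι p) with he
  have hx : ι p ∈ e.baseSet := FiberBundle.mem_baseSet_trivializationAt' (ι p)
  have hnear : ∀ᶠ y in nhds (ι p), y ∈ e.baseSet := e.open_baseSet.mem_nhds hx
  set A : N → F →L[ℝ] F := fun y => ContinuousLinearMap.inCoordinates F (TangentSpace (𝓡 d))
    F (TangentSpace (𝓡 d)) (ι p) y (ι p) y (φ y) with hAdef
  have hA : MDifferentiableAt (𝓡 d) 𝓘(ℝ, F →L[ℝ] F) A (ι p) :=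
    ((mdifferentiableAt_hom_bundle _).1 hφ).2
  have hv : MDifferentiableAt (𝓡 m) 𝓘(ℝ, F) (fun q => (e ⟨ι q, V q⟩).2) p :=
    ((mdifferentiableAt_totalSpace _ _).1 hV).2
  -- At the base point the matrix `A` is `φ` conjugated by the trivialization.
  have hsymm : ∀ z : F, e.symmL ℝ (ι p) (A (ι p) z) = φ (ι p) (e.symmL ℝ (ι p) z) := by
    intro z
    simp only [hAdef, ContinuousLinearMap.inCoordinates, ContinuousLinearMap.comp_apply]
    exact e.symmL_continuousLinearMapAt hx _
  have hφext : MDifferentiableAt (𝓡 d) (𝓡 d).tangent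
      (fun y => (⟨y, φ y (FiberBundle.extend F (V p) y)⟩ : TangentBundle (𝓡 d) N)) (ι p) :=
    hφ.clm_bundle_apply (FiberBundle.mdifferentiableAt_extend (I := 𝓡 d) F (V p))
  have h1 : (fun q => (e ⟨ι q, φ (ι q) (V q)⟩).2) =ᶠ[nhds p]
      fun q => (A ∘ ι) q (e ⟨ι q, V q⟩).2 := by
    filter_upwards [hι.continuousAt.eventually hnear] with q hq
    exact trivializationAt_apply_eq_inCoordinates hq _ _
  have h2 : (fun y => (e ⟨y, φ y (FiberBundle.extend F (V p) y)⟩).2) =ᶠ[nhds (ι p)]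
      fun y => A y (e ⟨ι p, V p⟩).2 := by
    filter_upwards [hnear] with y hy
    rw [trivializationAt_apply_eq_inCoordinates hy]
    simp only [FiberBundle.extend, hAdef]
    rw [e.apply_mk_symm hy]
  have hcomp : mvfderiv (𝓡 m) (A ∘ ι) p u
      = mvfderiv (𝓡 d) A (ι p) (mfderiv (𝓡 m) (𝓡 d) ι p u) :=
    mfderiv_comp_apply p hA hι u
  rw [covAlong_eq_symmL, covAlong_eq_symmL, cov_eq_symmL_mvfderiv_add cov hφext,
    mvfderiv_congr h1, mvfderiv_congr h2, mvfderiv_clm_apply (hA.comp p hι) hv,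
    mvfderiv_clm_apply hA mdifferentiableAt_const, mvfderiv_const, hcomp]
  simp only [FiberBundle.extend_apply_self, map_add, Function.comp_apply,
    zero_apply, map_zero, add_zero]
  -- After cancellation the two sides differ exactly by `A dv(u)` against `φ` of `dv(u)`.
  have hs := hsymm (mvfderiv (𝓡 m) (fun q => (e ⟨ι q, V q⟩).2) p u)
  rw [← sub_eq_zero] at hs ⊢
  refine Eq.trans ?_ hs
  abel

end Connection

/-! ### The nearly Sasakian identity along the immersion. -/

section Submanifold

variable {m d : ℕ} {M N : Type*}
  [TopologicalSpace M] [ChartedSpace (EuclideanSpace ℝ (Fin m)) M] [IsManifold (𝓡 m) ∞ M]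
  [TopologicalSpace N] [ChartedSpace (EuclideanSpace ℝ (Fin d)) N] [IsManifold (𝓡 d) ∞ N]
  {g : SemiRiemannianMetric d N} {ι : M → N}

lemma mdifferentiableAt_push (hι : ContMDiff (𝓡 m) (𝓡 d) ∞ ι)
    {X : ∀ p : M, TangentSpace (𝓡 m) p}
    (hX : ContMDiff (𝓡 m) (𝓡 m).tangent ∞ (fun p => (⟨p, X p⟩ : TangentBundle (𝓡 m) M)))
    (p : M) :
    MDifferentiableAt (𝓡 m) (𝓡 d).tangent
      (fun q => (⟨ι q, push ι X q⟩ : TangentBundle (𝓡 d) N)) p := by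
  have h : ContMDiff (𝓡 m) (𝓡 d).tangent ∞ (fun q => tangentMap (𝓡 m) (𝓡 d) ι ⟨q, X q⟩) :=
    (hι.contMDiff_tangentMap (m := ∞) (by simp)).comp hX
  exact (h p).mdifferentiableAt (by simp)

/-- The nearly `μ`-Sasakian identity for vector fields tangent to a submanifold. -/
lemma covAlong_φ_add_covAlong_φ
    {cov : CovariantDerivative (𝓡 d) (EuclideanSpace ℝ (Fin d))
      (TangentSpace (𝓡 d) : N → Type _)}
    {J : AlmostContactMetricStructure g} {μ : ℝ} (hJ : IsNearlySasakian μ cov J)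
    (hι : ContMDiff (𝓡 m) (𝓡 d) ∞ ι) {X Y : ∀ p : M, TangentSpace (𝓡 m) p}
    (hX : ContMDiff (𝓡 m) (𝓡 m).tangent ∞ (fun p => (⟨p, X p⟩ : TangentBundle (𝓡 m) M)))
    (hY : ContMDiff (𝓡 m) (𝓡 m).tangent ∞ (fun p => (⟨p, Y p⟩ : TangentBundle (𝓡 m) M)))
    (p : M) :
    covAlong cov ι (fun q => J.φ (ι q) (push ι X q)) p (Y p)
        + covAlong cov ι (fun q => J.φ (ι q) (push ι Y q)) p (X p)
      = J.φ (ι p) (covAlong cov ι (push ι Y) p (X p) + covAlong cov ι (push ι X) p (Y p))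
        + μ • ((2 * g.val (ι p) (push ι X p) (push ι Y p)) • J.ξ (ι p)
          - J.η (ι p) (push ι Y p) • push ι X p - J.η (ι p) (push ι X p) • push ι Y p) := by
  have hφ := (J.φ_smooth (ι p)).mdifferentiableAt (by simp)
  have hιp := (hι p).mdifferentiableAt (by simp)
  have h1 := covAlong_endomorphism_sub cov ι J.φ (push ι X) p (Y p) hφ hιp
    (mdifferentiableAt_push hι hX p)
  have h2 := covAlong_endomorphism_sub cov ι J.φ (push ι Y) p (X p) hφ hιp
    (mdifferentiableAt_push hι hY p)
  -- The ambient identity is needed only at `ι p`, for local extensions of the two vectors `push ι X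
  -- p` and `push ι Y p`.
  have h3 := hJ _ _ (ι p) (smoothFieldAt_extend (push ι X p)) (smoothFieldAt_extend (push ι Y p))
  simp only [covφ, FiberBundle.extend_apply_self] at h3
  rw [sub_eq_iff_eq_add] at h1 h2
  rw [h1, h2, ← h3, map_add]
  simp only [push]
  abel

lemma AlmostContactMetricStructure.η_eq_zero_of_mem_tangentDist
    {J : AlmostContactMetricStructure g} {L : LightlikeSubmanifold g m ι} {p : M}
    (hξ : J.ξ (ι p) ∈ L.screenTr p) {v : TangentSpace (𝓡 d) (ι p)}
    (hv : v ∈ tangentDist m ι p) : J.η (ι p) v = 0 := by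
  have h : J.ξ (ι p) ∈ normalDist g m ι p := by
    rw [← (L.normal_eq p).2]
    exact Submodule.mem_sup_right hξ
  rw [J.η_eq, g.symm]
  exact h v hv

/-! ### How `φ` and the projections act on `D̄` and `tr(TM)`. -/

namespace QGCR

variable {J : AlmostContactMetricStructure g} {L : LightlikeSubmanifold g m ι} (Q : QGCR J L)

lemma Dbar_le_tangentDist (p : M) : Q.Dbar p ≤ tangentDist m ι p := by
  rw [← (Q.tangent_eq_D p).2]
  exact le_sup_right

/-- The tangential projection fixes `D̄` and kills `tr(TM)`. This reduces the theorem to a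
membership in `D̄ ⊕ tr(TM)`. -/
lemma projD_tanProj_eq_zero {p : M} {z : TangentSpace (𝓡 d) (ι p)}
    (hz : z ∈ Q.Dbar p ⊔ L.tr p) : Q.projD p (L.tanProj p z) = 0 := by
  obtain ⟨a, ha, b, hb, rfl⟩ := Submodule.mem_sup.1 hz
  have h1 : L.tanProj p a = a :=
    Submodule.projection_apply_of_mem_left _ (Q.Dbar_le_tangentDist p ha)
  have h2 : L.tanProj p b = 0 := (Submodule.projection_apply_eq_zero_iff _).2 hb
  rw [map_add, h1, h2, add_zero]
  exact (Submodule.projection_apply_eq_zero_iff _).2 (Submodule.mem_sup_left ha)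

namespace IsTransversalSplitting

variable {Q} {G : DistAlong d ι} (hG : Q.IsTransversalSplitting G)
include hG

lemma φ_mem_tr {p : M} {v : TangentSpace (𝓡 d) (ι p)} (hv : v ∈ Q.Dbar p) :
    J.φ (ι p) v ∈ L.tr p := by
  rw [← (hG.tr_eq p).2]
  exact Submodule.mem_sup_left (Submodule.mem_sup_left (Submodule.mem_map_of_mem hv))

lemma ξ_mem_tr (p : M) : J.ξ (ι p) ∈ L.tr p := by
  rw [← (hG.tr_eq p).2]
  exact Submodule.mem_sup_right (Submodule.mem_span_singleton_self _)

/-- On a co-screen submanifold, `φ` maps `tr(TM)` into `D̄ ⊕ tr(TM)`. -/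
lemma φ_mem_of_mem_tr (hQ : Q.IsCoScreen) {p : M} {w : TangentSpace (𝓡 d) (ι p)}
    (hw : w ∈ L.tr p) : J.φ (ι p) w ∈ Q.Dbar p ⊔ L.tr p := by
  rw [← (hG.tr_eq p).2] at hw
  obtain ⟨a, ha, b, hb, rfl⟩ := Submodule.mem_sup.1 hw
  obtain ⟨_, ⟨v, hv, rfl⟩, c, hc, rfl⟩ := Submodule.mem_sup.1 ha
  obtain ⟨t, rfl⟩ := Submodule.mem_span_singleton.1 hb
  -- `φ` returns the summand `φ D̄` to `D̄`, as `η` vanishes there; `𝓖` is invariant and `ξ` is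
  -- killed.
  have hv' : J.φ (ι p) (J.φ (ι p) v) = -v := by
    rw [J.φ_φ, J.η_eq_zero_of_mem_tangentDist (hQ p) (Q.Dbar_le_tangentDist p hv), zero_smul,
      add_zero]
  have hc' : J.φ (ι p) c ∈ L.tr p := by
    rw [← (hG.tr_eq p).2]
    refine Submodule.mem_sup_left (Submodule.mem_sup_right ?_)
    rw [← hG.invariant p]
    exact Submodule.mem_map_of_mem hc
  rw [map_add, map_add, map_smul, J.φ_ξ, smul_zero, add_zero]
  exact add_mem (Submodule.mem_sup_left (hv'.symm ▸ neg_mem hv)) (Submodule.mem_sup_right hc')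

lemma φTr_eq_φTan {X : ∀ p : M, TangentSpace (𝓡 m) p} (hX : L.IsSection Q.Dbar X) :
    Q.φTr X = Q.φTan X :=
  funext fun p => Submodule.projection_apply_of_mem_left _ (hG.φ_mem_tr (hX.2 p))

end IsTransversalSplitting

end QGCR

end Submanifold

end LightlikeGeometry

theorem mainTheorem7 {n m : ℕ} {N M : Type*}
    [TopologicalSpace N] [T2Space N] [SecondCountableTopology N]
    [ChartedSpace (EuclideanSpace ℝ (Fin (2 * n + 1))) N] [IsManifold (𝓡 (2 * n + 1)) ∞ N]
    [TopologicalSpace M] [T2Space M] [SecondCountableTopology M]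
    [ChartedSpace (EuclideanSpace ℝ (Fin m)) M] [IsManifold (𝓡 m) ∞ M]
    (g : SemiRiemannianMetric (2 * n + 1) N)
    (cov : CovariantDerivative (𝓡 (2 * n + 1)) (EuclideanSpace ℝ (Fin (2 * n + 1)))
      (TangentSpace (𝓡 (2 * n + 1)) : N → Type _))
    (hcov : IsLeviCivita g cov)
    (J : AlmostContactMetricStructure g) (μ : ℝ) (hJ : IsNearlySasakian μ cov J)
    (ι : M → N) (L : LightlikeSubmanifold g m ι) (Q : QGCR J L) (hQ : Q.IsCoScreen)
    (G : DistAlong (2 * n + 1) ι) (hG : Q.IsTransversalSplitting G)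
    (hD : L.NearlyAutoParallel cov Q.Dbar)
    (X Y : ∀ p : M, TangentSpace (𝓡 m) p)
    (hX : L.IsSection Q.Dbar X) (hY : L.IsSection Q.Dbar Y) (p : M) :
    Q.projD p (L.shape cov (Q.φTr X) Y p + L.shape cov (Q.φTan Y) X p) = 0 := by
  have hηX := J.η_eq_zero_of_mem_tangentDist (hQ p) (Q.Dbar_le_tangentDist p (hX.2 p))
  have hηY := J.η_eq_zero_of_mem_tangentDist (hQ p) (Q.Dbar_le_tangentDist p (hY.2 p))
  have key := covAlong_φ_add_covAlong_φ hJ L.smooth hX.1 hY.1 p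
  rw [hηX, hηY, zero_smul, zero_smul, sub_zero, sub_zero] at key
  set c := covAlong cov ι (push ι Y) p (X p) + covAlong cov ι (push ι X) p (Y p) with hc
  have hctan : L.tanProj p c ∈ Q.Dbar p := by
    rw [hc, map_add]
    exact hD X Y hX hY p
  have hctr : c - L.tanProj p c ∈ L.tr p := Submodule.sub_projection_mem _ c
  have hφc : J.φ (ι p) c ∈ Q.Dbar p ⊔ L.tr p := by
    -- The tangential part of `c` goes to `φ D̄`, inside `tr(TM)`; the transversal part goes to `D̄
    -- ⊕ tr(TM)`.
    rw [← add_sub_cancel (L.tanProj p c) c, map_add]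
    exact add_mem (Submodule.mem_sup_right (hG.φ_mem_tr hctan)) (hG.φ_mem_of_mem_tr hQ hctr)
  have hmem := Q.projD_tanProj_eq_zero (add_mem hφc (Submodule.mem_sup_right
    (Submodule.smul_mem _ μ (Submodule.smul_mem _
      (2 * g.val (ι p) (push ι X p) (push ι Y p)) (hG.ξ_mem_tr p)))))
  rw [← key] at hmem
  -- Both shape operators are now those of fields `φX`, `φY`, so their sum is minus the tangential
  -- part of the left side of `key`.
  rw [hG.φTr_eq_φTan hX]
  simp only [LightlikeSubmanifold.shape]
  rw [← neg_add, ← map_add, map_neg, neg_eq_zero]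
  exact hmem
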